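/- A G\"odel set is a closed set $V\subseteq[0,1]$ with $0,1\in V$. Consider first-order formulas without equality, built from $\bot,\wedge,\vee,\supset,\forall,\exists$ over a language with, for every arity, countably many predicate symbols and countably many function symbols (those of arity $0$ are the constants). A $V$-interpretation $\mathcal I$ consists of a nonempty universe $U$, an interpretation of the function symbols by functions on $U$ and of the predicate symbols by functions with values in $V$, and an element of $U$ for each variable. Truth values are given by $\mathcal I(\bot)=0$, $\mathcal I(A\wedge B)=\min\{\mathcal I(A),\mathcal I(B)\}$, $\mathcal I(A\vee B)=\max\{\mathcal I(A),\mathcal I(B)\}$, $\mathcal I(A\supset B)=1$ if $\mathcal I(A)\le\mathcal I(B)$ and $\mathcal I(A\supset B)=\mathcal I(B)$ otherwise, $\mathcal I(\forall x\,A(x))=\inf_{u\in U}\mathcal I(A(u))$ and $\mathcal I(\exists x\,A(x))=\sup_{u\in U}\mathcal I(A(u))$. A formula $A$ is $1$-satisfiable in the G\"odel logic $G_V$ if $\mathcal I(A)=1$ for some $V$-interpretation $\mathcal I$. A formula is monadic if it contains no predicate symbol of arity greater than $1$ and no function symbol of positive arity. Let $V$ be a G\"odel set in which $0$ is an isolated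 point. Then a monadic formula is $1$-satisfiable in $G_V$ if and only if it is satisfiable in classical first-order logic, and $1$-satisfiability of monadic formulas in $G_V$ is decidable: the set of (G\"odel numbers of) monadic formulas that are $1$-satisfiable in $G_V$ is recursive. -/

import Mathlib

universe u

namespace GodelLogic

/-- Terms of the first-order language. Variables are named by natural numbers; for every arity `n`
there are countably many function symbols `(n, k)`. The symbols of arity `0` are the constants. -/
inductive Term : Type
  | var (x : ℕ) : Term
  | app (n k : ℕ) (ts : Fin n → Term) : Term

/-- Formulas of the first-order language, without equality. For every arity `n` there are countably
many predicate symbols `(n, k)`. Negation `¬ A` is the abbreviation `A ⊃ ⊥`. -/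
inductive Formula : Type
  | bot : Formula
  | atom (n k : ℕ) (ts : Fin n → Term) : Formula
  | and (A B : Formula) : Formula
  | or (A B : Formula) : Formula
  | imp (A B : Formula) : Formula
  | all (x : ℕ) (A : Formula) : Formula
  | ex (x : ℕ) (A : Formula) : Formula

/-- The term contains no function symbol of positive arity: it is a variable or a constant. -/
def Term.IsFunctionFree : Term → Prop
  | .var _ => True
  | .app n _ _ => n = 0

/-- Monadic formulas: no predicate symbol of arity greater than one and no function symbol of
positive arity occurs in the formula. -/
def Formula.IsMonadic : Formula → Prop
  | .bot => True
  | .atom n _ ts => n ≤ 1 ∧ ∀ i, (ts i).IsFunctionFree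
  | .and A B => A.IsMonadic ∧ B.IsMonadic
  | .or A B => A.IsMonadic ∧ B.IsMonadic
  | .imp A B => A.IsMonadic ∧ B.IsMonadic
  | .all _ A => A.IsMonadic
  | .ex _ A => A.IsMonadic

/-! ### Gödel numbering -/

/-- Gödel number of a term; finite lists of numbers are coded by Mathlib's standard
(primitive recursive) coding of lists. -/
def Term.code : Term → ℕ
  | .var x => Nat.pair 0 x
  | .app _ k ts => Nat.pair 1 (Nat.pair k (Encodable.encode (List.ofFn fun i => (ts i).code)))

/-- Gödel number of a formula. -/
def Formula.code : Formula → ℕ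
  | .bot => Nat.pair 0 0
  | .atom _ k ts =>
      Nat.pair 1 (Nat.pair k (Encodable.encode (List.ofFn fun i => (ts i).code)))
  | .and A B => Nat.pair 2 (Nat.pair A.code B.code)
  | .or A B => Nat.pair 3 (Nat.pair A.code B.code)
  | .imp A B => Nat.pair 4 (Nat.pair A.code B.code)
  | .all x A => Nat.pair 5 (Nat.pair x A.code)
  | .ex x A => Nat.pair 6 (Nat.pair x A.code)

theorem Term.code_injective : Function.Injective Term.code := by
  intro s
  induction s with
  | var x =>
    intro t h
    cases t <;> simp_all [Term.code, Nat.pair_eq_pair]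
  | app n k ts ih =>
    intro t h
    cases t with
    | var y => simp [Term.code, Nat.pair_eq_pair] at h
    | app m l us =>
      simp only [Term.code, Nat.pair_eq_pair, true_and, Encodable.encode_inj] at h
      obtain ⟨rfl, h⟩ := h
      have hnm : n = m := by simpa using congrArg List.length h
      subst hnm
      have h' := List.ofFn_injective h
      congr
      funext i
      exact ih i (congrFun h' i)

/-- Different formulas have different Gödel numbers. -/
theorem Formula.code_injective : Function.Injective Formula.code := by
  intro A
  induction A with
  | bot => intro B h; cases B <;> simp_all [Formula.code, Nat.pair_eq_pair]
  | atom n k ts =>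
    intro B h
    cases B with
    | atom m l us =>
      simp only [Formula.code, Nat.pair_eq_pair, true_and, Encodable.encode_inj] at h
      obtain ⟨rfl, h⟩ := h
      have hnm : n = m := by simpa using congrArg List.length h
      subst hnm
      have h' := List.ofFn_injective h
      congr
      funext i
      exact Term.code_injective (congrFun h' i)
    | _ => simp [Formula.code, Nat.pair_eq_pair] at h
  | and A B ihA ihB =>
    intro C h
    cases C <;> simp [Formula.code, Nat.pair_eq_pair] at h
    rw [ihA h.1, ihB h.2]
  | or A B ihA ihB =>
    intro C h
    cases C <;> simp [Formula.code, Nat.pair_eq_pair] at h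
    rw [ihA h.1, ihB h.2]
  | imp A B ihA ihB =>
    intro C h
    cases C <;> simp [Formula.code, Nat.pair_eq_pair] at h
    rw [ihA h.1, ihB h.2]
  | all x A ih =>
    intro C h
    cases C <;> simp [Formula.code, Nat.pair_eq_pair] at h
    rw [h.1, ih h.2]
  | ex x A ih =>
    intro C h
    cases C <;> simp [Formula.code, Nat.pair_eq_pair] at h
    rw [h.1, ih h.2]

/-- A set of formulas is decidable if the set of Gödel numbers of its members is recursive. -/
def IsDecidable (S : Set Formula) : Prop :=
  ComputablePred fun m : ℕ => ∃ A ∈ S, A.code = m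

/-! ### Semantics of Gödel logics -/

/-- Gödel sets (truth value sets): closed subsets of `[0, 1]` containing `0` and `1`. -/
structure IsGodelSet (V : Set ℝ) : Prop where
  isClosed : IsClosed V
  subset_Icc : V ⊆ Set.Icc 0 1
  zero_mem : (0 : ℝ) ∈ V
  one_mem : (1 : ℝ) ∈ V

/-- Value of a term in a universe `U`, for given function symbols and a given assignment. -/
def Term.eval {U : Type u} (fn : (n k : ℕ) → (Fin n → U) → U) (s : ℕ → U) : Term → U
  | .var x => s x
  | .app n k ts => fn n k fun i => (ts i).eval fn s

/-- `V`-interpretations: a nonempty universe, functions on it for the function symbols, `V`-valued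
relations for the predicate symbols, and an element for each variable. -/
structure Interpretation (V : Set ℝ) where
  U : Type u
  nonempty : Nonempty U
  fn : (n k : ℕ) → (Fin n → U) → U
  pred : (n k : ℕ) → (Fin n → U) → V
  var : ℕ → U

/-- Truth value of a formula under an assignment `s` of the variables. -/
noncomputable def Interpretation.eval {V : Set ℝ} (I : Interpretation.{u} V) :
    Formula → (ℕ → I.U) → ℝ
  | .bot, _ => 0
  | .atom n k ts, s => I.pred n k fun i => (ts i).eval I.fn s
  | .and A B, s => min (I.eval A s) (I.eval B s)
  | .or A B, s => max (I.eval A s) (I.eval B s)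
  | .imp A B, s => if I.eval A s ≤ I.eval B s then 1 else I.eval B s
  | .all x A, s => ⨅ a : I.U, I.eval A (Function.update s x a)
  | .ex x A, s => ⨆ a : I.U, I.eval A (Function.update s x a)

/-- The truth value `I(A)`. -/
noncomputable def Interpretation.value {V : Set ℝ} (I : Interpretation.{u} V) (A : Formula) : ℝ :=
  I.eval A I.var

/-- All truth values lie in `V`; in particular the infima and suprema in the clauses for the
quantifiers are those of nonempty bounded sets of reals. -/
theorem Interpretation.eval_mem {V : Set ℝ} (hV : IsGodelSet V) (I : Interpretation.{u} V)
    (A : Formula) (s : ℕ → I.U) : I.eval A s ∈ V := by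
  have hU := I.nonempty
  induction A generalizing s with
  | bot => exact hV.zero_mem
  | atom n k ts => exact Subtype.coe_prop _
  | and A B ihA ihB =>
    rcases min_choice (I.eval A s) (I.eval B s) with h | h <;>
      simp only [Interpretation.eval, h, ihA, ihB]
  | or A B ihA ihB =>
    rcases max_choice (I.eval A s) (I.eval B s) with h | h <;>
      simp only [Interpretation.eval, h, ihA, ihB]
  | imp A B ihA ihB =>
    simp only [Interpretation.eval]
    split_ifs
    · exact hV.one_mem
    · exact ihB s
  | all x A ih =>
    refine hV.isClosed.closure_subset_iff.2 (Set.range_subset_iff.2 fun a => ih _)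
      (csInf_mem_closure (Set.range_nonempty fun a : I.U => I.eval A (Function.update s x a)) ?_)
    exact ⟨0, by rintro _ ⟨a, rfl⟩; exact (hV.subset_Icc (ih _)).1⟩
  | ex x A ih =>
    refine hV.isClosed.closure_subset_iff.2 (Set.range_subset_iff.2 fun a => ih _)
      (csSup_mem_closure (Set.range_nonempty fun a : I.U => I.eval A (Function.update s x a)) ?_)
    exact ⟨1, by rintro _ ⟨a, rfl⟩; exact (hV.subset_Icc (ih _)).2⟩

/-- `A` is `1`-satisfiable in the Gödel logic with truth value set `V`. -/
def OneSatisfiable (V : Set ℝ) (A : Formula) : Prop :=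
  ∃ I : Interpretation.{u} V, I.value A = 1

/-! ### Classical semantics -/

/-- Classical (two-valued) interpretations. -/
structure ClassicalInterpretation where
  U : Type u
  nonempty : Nonempty U
  fn : (n k : ℕ) → (Fin n → U) → U
  pred : (n k : ℕ) → (Fin n → U) → Prop
  var : ℕ → U

/-- Classical truth of a formula under an assignment of the variables. -/
def ClassicalInterpretation.Holds (M : ClassicalInterpretation.{u}) :
    Formula → (ℕ → M.U) → Prop
  | .bot, _ => False
  | .atom n k ts, s => M.pred n k fun i => (ts i).eval M.fn s
  | .and A B, s => M.Holds A s ∧ M.Holds B s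
  | .or A B, s => M.Holds A s ∨ M.Holds B s
  | .imp A B, s => M.Holds A s → M.Holds B s
  | .all x A, s => ∀ a : M.U, M.Holds A (Function.update s x a)
  | .ex x A, s => ∃ a : M.U, M.Holds A (Function.update s x a)

/-- `A` is satisfiable in classical logic. -/
def ClassicallySatisfiable (A : Formula) : Prop :=
  ∃ M : ClassicalInterpretation.{u}, M.Holds A M.var

end GodelLogic

namespace GodelLogic

/-! ### Truth value sets with isolated zero -/

/-! If `0` is isolated, the positive elements of `V` are bounded below by some `ε > 0`, so an
infimum of positive truth values stays positive. Hence "the value is positive" commutes with all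
connectives and quantifiers (`Interpretation.support_holds_iff`), and a formula of value `1` is true
in the classical model whose true atoms are those of positive value. Conversely, the values `0` and
`1` are closed under all operations (`ClassicalInterpretation.eval_toInterpretation`). Neither
direction needs monadicity.

Decidability thus reduces to classical monadic logic and its finite model property. The atoms of a
monadic formula with code `L` involve only predicate indices and term codes below `L`, so an element
matters only through its type: which of the first `L` unary predicates it satisfies. Therefore `2 ^
L` elements suffice, and `ClassicalInterpretation.truth_code_iff` transfers truth between a model
and a finite one realizing the same types. Finite models with assignments are coded by three bounded
numbers, truth in them is primitive recursive, and satisfiability becomes a bounded search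
(`classicallySatisfiable_iff_exists_truth`). -/

theorem exists_pos_le_of_not_accPt {V : Set ℝ}
    (h0 : ¬ AccPt (0 : ℝ) (Filter.principal V)) : ∃ ε > 0, ∀ v ∈ V, 0 < v → ε ≤ v := by
  rw [accPt_iff_nhds] at h0
  push Not at h0
  obtain ⟨N, hN, h⟩ := h0
  obtain ⟨ε, hε, hb⟩ := Metric.mem_nhds_iff.1 hN
  refine ⟨ε, hε, fun v hv hpos => ?_⟩
  by_contra! hlt
  refine hpos.ne' (h v ⟨hb ?_, hv⟩)
  rw [Metric.mem_ball, Real.dist_eq, sub_zero, abs_of_pos hpos]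
  exact hlt

/-- The classical interpretation in which an atom holds if its truth value is positive. -/
def Interpretation.support {V : Set ℝ} (I : Interpretation.{u} V) :
    ClassicalInterpretation.{u} where
  U := I.U
  nonempty := I.nonempty
  fn := I.fn
  pred n k v := 0 < (I.pred n k v : ℝ)
  var := I.var

theorem Interpretation.support_holds_iff {V : Set ℝ} (hV : IsGodelSet V)
    (h0 : ¬ AccPt (0 : ℝ) (Filter.principal V)) (I : Interpretation.{u} V) (A : Formula)
    (s : ℕ → I.U) : I.support.Holds A s ↔ 0 < I.eval A s := by
  have hU := I.nonempty
  obtain ⟨ε, hε, hle⟩ := exists_pos_le_of_not_accPt h0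
  have hnn : ∀ B t, 0 ≤ I.eval B t := fun B t => (hV.subset_Icc (I.eval_mem hV B t)).1
  have hle1 : ∀ B t, I.eval B t ≤ 1 := fun B t => (hV.subset_Icc (I.eval_mem hV B t)).2
  induction A generalizing s with
  | bot => simp [Interpretation.eval, ClassicalInterpretation.Holds]
  | atom n k ts => rfl
  | and A B ihA ihB =>
    exact (and_congr (ihA s) (ihB s)).trans lt_min_iff.symm
  | or A B ihA ihB =>
    exact (or_congr (ihA s) (ihB s)).trans lt_max_iff.symm
  | imp A B ihA ihB =>
    refine (imp_congr (ihA s) (ihB s)).trans ?_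
    simp only [Interpretation.eval]
    split_ifs with h
    · simpa using fun hA => lt_of_lt_of_le hA h
    -- Here the implication has the value of `B`, and `A` is positive because it exceeds `B ≥ 0`.
    · exact ⟨fun hAB => hAB ((hnn B s).trans_lt (not_le.1 h)), fun hB _ => hB⟩
  | all x A ih =>
    refine (forall_congr' fun a => ih (Function.update s x a)).trans ?_
    constructor
    -- The only place where isolation of `0` matters: the uniform gap `ε` bounds the infimum from
    -- below.
    · exact fun h => hε.trans_le (le_ciInf fun a => hle _ (I.eval_mem hV A _) (h a))
    · exact fun h a => h.trans_le (ciInf_le ⟨0, by rintro _ ⟨b, rfl⟩; exact hnn _ _⟩ a)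
  | ex x A ih =>
    refine (exists_congr fun a => ih (Function.update s x a)).trans ?_
    constructor
    · rintro ⟨a, ha⟩
      exact ha.trans_le (le_ciSup (f := fun a => I.eval A (Function.update s x a))
        ⟨1, by rintro _ ⟨b, rfl⟩; exact hle1 _ _⟩ a)
    · exact fun h => exists_lt_of_lt_ciSup h

open Classical in
/-- The two-valued interpretation given by a classical one. -/
noncomputable def ClassicalInterpretation.toInterpretation (M : ClassicalInterpretation.{u})
    {V : Set ℝ} (hV : IsGodelSet V) : Interpretation.{u} V where
  U := M.U
  nonempty := M.nonempty
  fn := M.fn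
  pred n k v := if M.pred n k v then ⟨1, hV.one_mem⟩ else ⟨0, hV.zero_mem⟩
  var := M.var

open Classical in
theorem ClassicalInterpretation.eval_toInterpretation (M : ClassicalInterpretation.{u})
    {V : Set ℝ} (hV : IsGodelSet V) (A : Formula) (s : ℕ → M.U) :
    (M.toInterpretation hV).eval A s = if M.Holds A s then 1 else 0 := by
  have hU := M.nonempty
  induction A generalizing s with
  | bot => simp [Interpretation.eval, ClassicalInterpretation.Holds]
  | atom n k ts =>
    by_cases h : M.pred n k fun i => (ts i).eval M.fn s <;>
      simp [Interpretation.eval, ClassicalInterpretation.Holds, toInterpretation, h]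
  | and A B ihA ihB =>
    simp only [Interpretation.eval, ClassicalInterpretation.Holds, ihA, ihB]
    split_ifs <;> simp_all
  | or A B ihA ihB =>
    simp only [Interpretation.eval, ClassicalInterpretation.Holds, ihA, ihB]
    split_ifs <;> simp_all
  | imp A B ihA ihB =>
    simp only [Interpretation.eval, ClassicalInterpretation.Holds, ihA, ihB]
    by_cases hA : M.Holds A s <;> by_cases hB : M.Holds B s <;> simp [hA, hB]
  | all x A ih =>
    have key : (M.toInterpretation hV).eval (.all x A) s =
        ⨅ a : M.U, if M.Holds A (Function.update s x a) then (1 : ℝ) else 0 :=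
      iInf_congr fun a => ih _
    rw [key]
    have hb : BddBelow (Set.range fun a : M.U =>
        if M.Holds A (Function.update s x a) then (1 : ℝ) else 0) :=
      ⟨0, by rintro _ ⟨a, rfl⟩; dsimp only; split_ifs <;> norm_num⟩
    by_cases h : M.Holds (.all x A) s
    · rw [if_pos h]
      have h' : ∀ a : M.U, M.Holds A (Function.update s x a) := h
      simp [h']
    · rw [if_neg h]
      obtain ⟨a, ha⟩ := not_forall.1 h
      refine le_antisymm ((ciInf_le hb a).trans (by simp [ha])) (le_ciInf fun b => ?_)
      split_ifs <;> norm_num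
  | ex x A ih =>
    have key : (M.toInterpretation hV).eval (.ex x A) s =
        ⨆ a : M.U, if M.Holds A (Function.update s x a) then (1 : ℝ) else 0 :=
      iSup_congr fun a => ih _
    rw [key]
    have hb : BddAbove (Set.range fun a : M.U =>
        if M.Holds A (Function.update s x a) then (1 : ℝ) else 0) :=
      ⟨1, by rintro _ ⟨a, rfl⟩; dsimp only; split_ifs <;> norm_num⟩
    by_cases h : M.Holds (.ex x A) s
    · rw [if_pos h]
      obtain ⟨a, ha⟩ := h
      refine le_antisymm (ciSup_le fun b => ?_) (le_trans (by simp [ha]) (le_ciSup hb a))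
      split_ifs <;> norm_num
    · rw [if_neg h]
      have h' : ∀ a : M.U, ¬ M.Holds A (Function.update s x a) := not_exists.1 h
      simp [h']

theorem oneSatisfiable_iff_classicallySatisfiable {V : Set ℝ} (hV : IsGodelSet V)
    (h0 : ¬ AccPt (0 : ℝ) (Filter.principal V)) (A : Formula) :
    OneSatisfiable.{u} V A ↔ ClassicallySatisfiable.{u} A := by
  constructor
  · rintro ⟨I, hI⟩
    refine ⟨I.support, (I.support_holds_iff hV h0 A I.var).2 ?_⟩
    exact zero_lt_one.trans_eq hI.symm
  · rintro ⟨M, hM⟩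
    exact ⟨M.toInterpretation hV, (M.eval_toInterpretation hV A M.var).trans (if_pos hM)⟩

/-! ### Digits of natural numbers -/

/-- The `i`-th digit of `n` in base `b`. -/
def digit (b n i : ℕ) : ℕ := n / b ^ i % b

theorem digit_lt {b : ℕ} (hb : 0 < b) (n i : ℕ) : digit b n i < b := Nat.mod_lt _ hb

theorem exists_digit_eq {b : ℕ} (L : ℕ) {f : ℕ → ℕ} (hf : ∀ i < L, f i < b) :
    ∃ n < b ^ L, ∀ i < L, digit b n i = f i := by
  let g : Fin L → Fin b := fun i => ⟨f i, hf i i.2⟩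
  refine ⟨finFunctionFinEquiv g, (finFunctionFinEquiv g).2, fun i hi => ?_⟩
  have h := congrFun (finFunctionFinEquiv.symm_apply_apply g) ⟨i, hi⟩
  -- The inverse of `finFunctionFinEquiv` is the digit function by definition.
  exact congrArg Fin.val h

/-- A natural number below `2 ^ L` with prescribed binary digits. -/
theorem exists_bits_iff (L : ℕ) (p : ℕ → Prop) :
    ∃ n < 2 ^ L, ∀ i < L, (digit 2 n i = 1 ↔ p i) := by
  classical
  obtain ⟨n, hn, h⟩ := exists_digit_eq (b := 2) L (f := fun i => if p i then 1 else 0)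
    (fun i _ => by split_ifs <;> norm_num)
  refine ⟨n, hn, fun i hi => ?_⟩
  rw [h i hi]
  simp

/-! ### Primitive recursive arithmetic and bounded quantifiers. -/

section Primrec

variable {α : Type*} [Primcodable α]

theorem primrec_nat_pow {f g : α → ℕ} (hf : Primrec f) (hg : Primrec g) :
    Primrec fun a => f a ^ g a :=
  (Primrec₂.unpaired'.1 Nat.Primrec.pow).comp hf hg

theorem primrec_digit {f g h : α → ℕ} (hf : Primrec f) (hg : Primrec g) (hh : Primrec h) :
    Primrec fun a => digit (f a) (g a) (h a) :=
  Primrec.nat_mod.comp (Primrec.nat_div.comp hg (primrec_nat_pow hf hh)) hf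

theorem primrecPred_exists_lt {f : α → ℕ} {p : ℕ → α → Prop} (hf : Primrec f)
    (hp : PrimrecPred fun x : ℕ × α => p x.1 x.2) : PrimrecPred fun a => ∃ x < f a, p x a :=
  ((PrimrecRel.exists_mem_list (R := p) hp).comp (Primrec.list_range.comp hf) Primrec.id).of_eq
    (by simp)

theorem primrecPred_forall_lt {f : α → ℕ} {p : ℕ → α → Prop} (hf : Primrec f)
    (hp : PrimrecPred fun x : ℕ × α => p x.1 x.2) : PrimrecPred fun a => ∀ x < f a, p x a :=
  ((PrimrecRel.forall_mem_list (R := p) hp).comp (Primrec.list_range.comp hf) Primrec.id).of_eq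
    (by simp)

theorem primrecPred_eq {f g : α → ℕ} (hf : Primrec f) (hg : Primrec g) :
    PrimrecPred fun a => f a = g a :=
  Primrec.eq.comp hf hg

theorem primrecPred_eq_true {f : α → Bool} (hf : Primrec f) : PrimrecPred fun a => f a = true :=
  Primrec.eq.comp hf (Primrec.const true)

end Primrec

/-! ### Course-of-values recursion -/

section CourseOfValues

variable {α σ : Type*}

/-- The list of the first `n` values of the function defined by course-of-values recursion. -/
def courseOfValues (step : α → List σ → σ) (a : α) : ℕ → List σ
  | 0 => []
  | n + 1 => courseOfValues step a n ++ [step a (courseOfValues step a n)]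

@[simp]
theorem length_courseOfValues (step : α → List σ → σ) (a : α) (n : ℕ) :
    (courseOfValues step a n).length = n := by
  induction n with
  | zero => rfl
  | succ n ih => simp [courseOfValues, ih]

theorem getD_courseOfValues (step : α → List σ → σ) (a : α) (d : σ) {i n : ℕ} (h : i < n) :
    (courseOfValues step a n).getD i d = step a (courseOfValues step a i) := by
  induction n with
  | zero => omega
  | succ n ih =>
    rcases Nat.lt_succ_iff_lt_or_eq.1 h with h | rfl
    · rw [courseOfValues, List.getD_append _ _ _ _ (by simpa using h), ih h]
    · rw [courseOfValues, List.getD_append_right _ _ _ _ (by simp)]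
      simp

theorem primrec_courseOfValues [Primcodable α] [Primcodable σ] {step : α → List σ → σ}
    (h : Primrec₂ step) : Primrec₂ (courseOfValues step) := by
  refine (Primrec.nat_rec (f := fun _ : α => ([] : List σ))
    (g := fun a p => p.2 ++ [step a p.2]) (Primrec.const _) ?_).of_eq fun a n => ?_
  · have h2 : Primrec fun x : α × ℕ × List σ => x.2.2 := Primrec.snd.comp Primrec.snd
    exact Primrec.list_concat.comp h2 (h.comp Primrec.fst h2)
  · induction n with
    | zero => rfl
    | succ n ih => simp only [courseOfValues, ← ih]

end CourseOfValues

/-! ### Recognizing codes of monadic formulas -/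

/-- `n` is the code of a monadic formula, given the codes of monadic formulas below `n`. -/
def MonadicStep (T : ℕ → Prop) (n : ℕ) : Prop :=
  n = 0 ∨
  (n.unpair.1 = 1 ∧ (n.unpair.2.unpair.2 = 0 ∨ (n.unpair.2.unpair.2 ≠ 0 ∧
    (n.unpair.2.unpair.2 - 1).unpair.2 = 0 ∧
    ((n.unpair.2.unpair.2 - 1).unpair.1.unpair.1 = 0 ∨
      ((n.unpair.2.unpair.2 - 1).unpair.1.unpair.1 = 1 ∧
        (n.unpair.2.unpair.2 - 1).unpair.1.unpair.2.unpair.2 = 0))))) ∨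
  ((n.unpair.1 = 2 ∨ n.unpair.1 = 3 ∨ n.unpair.1 = 4) ∧
    T n.unpair.2.unpair.1 ∧ T n.unpair.2.unpair.2) ∨
  ((n.unpair.1 = 5 ∨ n.unpair.1 = 6) ∧ T n.unpair.2.unpair.2)

open Classical in
/-- The Boolean form of `MonadicStep`, for a list of values. -/
noncomputable def monadicStep (_ : Unit) (l : List Bool) : Bool :=
  decide (MonadicStep (fun i => l.getD i false = true) l.length)

/-- `n` is the code of a monadic formula, as a primitive recursive predicate. -/
def IsMonadicCode (n : ℕ) : Prop :=
  monadicStep () (courseOfValues monadicStep () n) = true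

theorem unpair_snd_lt {n : ℕ} (h : n.unpair.1 ≠ 0) : n.unpair.2 < n := by
  have := Nat.add_le_pair n.unpair.1 n.unpair.2
  rw [Nat.pair_unpair] at this
  omega

theorem unpair_snd_fst_lt {n : ℕ} (h : n.unpair.1 ≠ 0) : n.unpair.2.unpair.1 < n :=
  (Nat.unpair_left_le _).trans_lt (unpair_snd_lt h)

theorem unpair_snd_snd_lt {n : ℕ} (h : n.unpair.1 ≠ 0) : n.unpair.2.unpair.2 < n :=
  (Nat.unpair_right_le _).trans_lt (unpair_snd_lt h)

/-- A nonzero tag makes both components smaller than `n`; with tag `0` they need not be smaller, but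
`T` is not consulted. This makes the default values of the list lookups harmless. -/
theorem MonadicStep.congr {T T' : ℕ → Prop} {n : ℕ} (h : ∀ i < n, (T i ↔ T' i)) :
    MonadicStep T n ↔ MonadicStep T' n := by
  by_cases h0 : n.unpair.1 = 0
  · simp [MonadicStep, h0]
  · simp only [MonadicStep, h _ (unpair_snd_fst_lt h0), h _ (unpair_snd_snd_lt h0)]

theorem isMonadicCode_iff (n : ℕ) : IsMonadicCode n ↔ MonadicStep IsMonadicCode n := by
  classical
  rw [IsMonadicCode, monadicStep, decide_eq_true_iff, length_courseOfValues]
  refine MonadicStep.congr fun i hi => ?_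
  rw [getD_courseOfValues _ _ _ hi, IsMonadicCode]

theorem primrec_monadicStep : Primrec₂ monadicStep := by
  have hl : Primrec fun x : Unit × List Bool => x.2 := Primrec.snd
  have hn : Primrec fun x : Unit × List Bool => x.2.length := Primrec.list_length.comp hl
  have fst {f : Unit × List Bool → ℕ} (hf : Primrec f) : Primrec fun x => (f x).unpair.1 :=
    Primrec.fst.comp (Primrec.unpair.comp hf)
  have snd {f : Unit × List Bool → ℕ} (hf : Primrec f) : Primrec fun x => (f x).unpair.2 :=
    Primrec.snd.comp (Primrec.unpair.comp hf)
  have c {f : Unit × List Bool → ℕ} (hf : Primrec f) (k : ℕ) : PrimrecPred fun x => f x = k :=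
    primrecPred_eq hf (Primrec.const k)
  have hT {f : Unit × List Bool → ℕ} (hf : Primrec f) :
      PrimrecPred fun x : Unit × List Bool => x.2.getD (f x) false = true :=
    primrecPred_eq_true ((Primrec.list_getD false).comp hl hf)
  have ht := fst hn
  have hb := snd (snd hn)
  have hb' := Primrec.nat_sub.comp hb (Primrec.const 1)
  have key : PrimrecPred fun x : Unit × List Bool =>
      MonadicStep (fun i => x.2.getD i false = true) x.2.length :=
    (c hn 0).or <| ((c ht 1).and <| (c hb 0).or <| (c hb 0).not.and <| (c (snd hb') 0).and <|
      (c (fst (fst hb')) 0).or <| (c (fst (fst hb')) 1).and (c (snd (snd (fst hb'))) 0)).or <|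
      (((c ht 2).or <| (c ht 3).or (c ht 4)).and <| (hT (fst (snd hn))).and (hT hb)).or <|
      ((c ht 5).or (c ht 6)).and (hT hb)
  classical exact key.decide

theorem primrecPred_isMonadicCode : PrimrecPred IsMonadicCode :=
  primrecPred_eq_true (primrec_monadicStep.comp (Primrec.const ())
    ((primrec_courseOfValues primrec_monadicStep).comp (Primrec.const ()) Primrec.id))

theorem exists_isFunctionFree_code_eq_iff (c : ℕ) : (∃ t : Term, t.IsFunctionFree ∧ t.code = c) ↔
    c.unpair.1 = 0 ∨ (c.unpair.1 = 1 ∧ c.unpair.2.unpair.2 = 0) := by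
  constructor
  · rintro ⟨t, ht, rfl⟩
    cases t with
    | var x => simp [Term.code]
    | app n k ts =>
      obtain rfl : n = 0 := ht
      simp [Term.code]
  · rintro (h | ⟨h, h'⟩)
    · refine ⟨.var c.unpair.2, trivial, ?_⟩
      rw [Term.code, ← h, Nat.pair_unpair]
    · refine ⟨.app 0 c.unpair.2.unpair.1 Fin.elim0, rfl, ?_⟩
      have : Nat.pair c.unpair.2.unpair.1 0 = c.unpair.2 := by rw [← h', Nat.pair_unpair]
      simp only [Term.code, List.ofFn_zero, Encodable.encode_list_nil, this]
      rw [← h, Nat.pair_unpair]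

theorem isMonadicCode_iff_exists (n : ℕ) :
    IsMonadicCode n ↔ ∃ A : Formula, A.IsMonadic ∧ A.code = n := by
  constructor
  · induction n using Nat.strong_induction_on with
    | _ n ih =>
    rw [isMonadicCode_iff]
    have hn : n = Nat.pair n.unpair.1 (Nat.pair n.unpair.2.unpair.1 n.unpair.2.unpair.2) := by
      rw [Nat.pair_unpair, Nat.pair_unpair]
    rintro (rfl | ⟨h1, h⟩ | ⟨h1, hA, hB⟩ | ⟨h1, hA⟩)
    · exact ⟨.bot, trivial, rfl⟩
    -- The empty argument list has code `0` and `[t]` has code `Nat.pair t.code 0 + 1`, so the code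
    -- of the list reveals the arity.
    · rcases h with h | ⟨h, h', ht⟩
      · refine ⟨.atom 0 n.unpair.2.unpair.1 Fin.elim0, ⟨zero_le_one, fun i => i.elim0⟩, ?_⟩
        conv_rhs => rw [hn, h1, h]
        simp [Formula.code]
      · obtain ⟨t, ht, htc⟩ := (exists_isFunctionFree_code_eq_iff _).2 ht
        refine ⟨.atom 1 n.unpair.2.unpair.1 fun _ => t, ⟨le_rfl, fun _ => ht⟩, ?_⟩
        conv_rhs => rw [hn, h1]
        have : n.unpair.2.unpair.2 = Nat.succ (Nat.pair t.code 0) := by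
          rw [htc, ← h', Nat.pair_unpair]
          omega
        simp [Formula.code, this]
    · have h0 : n.unpair.1 ≠ 0 := by omega
      obtain ⟨A, hA, hAc⟩ := ih _ (unpair_snd_fst_lt h0) hA
      obtain ⟨B, hB, hBc⟩ := ih _ (unpair_snd_snd_lt h0) hB
      rcases h1 with h1 | h1 | h1
      · exact ⟨.and A B, ⟨hA, hB⟩, by rw [Formula.code, hAc, hBc, ← h1, ← hn]⟩
      · exact ⟨.or A B, ⟨hA, hB⟩, by rw [Formula.code, hAc, hBc, ← h1, ← hn]⟩
      · exact ⟨.imp A B, ⟨hA, hB⟩, by rw [Formula.code, hAc, hBc, ← h1, ← hn]⟩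
    · have h0 : n.unpair.1 ≠ 0 := by omega
      obtain ⟨A, hA, hAc⟩ := ih _ (unpair_snd_snd_lt h0) hA
      rcases h1 with h1 | h1
      · exact ⟨.all n.unpair.2.unpair.1 A, hA, by rw [Formula.code, hAc, ← h1, ← hn]⟩
      · exact ⟨.ex n.unpair.2.unpair.1 A, hA, by rw [Formula.code, hAc, ← h1, ← hn]⟩
  · rintro ⟨A, hA, rfl⟩
    induction A with
    | bot => exact (isMonadicCode_iff _).2 (.inl rfl)
    | atom n k ts =>
      refine (isMonadicCode_iff _).2 (.inr (.inl ?_))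
      obtain ⟨hn, hts⟩ := hA
      rcases Nat.le_one_iff_eq_zero_or_eq_one.1 hn with rfl | rfl
      · simp [Formula.code]
      · have := (exists_isFunctionFree_code_eq_iff _).1 ⟨ts 0, hts 0, rfl⟩
        simpa [Formula.code] using this
    | and A B ihA ihB =>
      rw [isMonadicCode_iff]; simp [MonadicStep, Formula.code, ihA hA.1, ihB hA.2]
    | or A B ihA ihB =>
      rw [isMonadicCode_iff]; simp [MonadicStep, Formula.code, ihA hA.1, ihB hA.2]
    | imp A B ihA ihB =>
      rw [isMonadicCode_iff]; simp [MonadicStep, Formula.code, ihA hA.1, ihB hA.2]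
    | all x A ih => rw [isMonadicCode_iff]; simp [MonadicStep, Formula.code, ih hA]
    | ex x A ih => rw [isMonadicCode_iff]; simp [MonadicStep, Formula.code, ih hA]

/-! ### Evaluating codes of monadic formulas in finite interpretations

The universe is `{0, …, N - 1}`. The digits of `w` in base `N` give for each element a number whose
binary digits say which unary predicates hold there, the binary digits of `z` are the values of the
nullary predicates, and the digits of `e` in base `N` are the values of the terms with code below
`L`. -/

/-- The formula with code `n` is true at `e`, if `T` is truth for formulas with smaller codes. -/
def TruthStep (N L w z : ℕ) (T : ℕ → ℕ → Prop) (n e : ℕ) : Prop :=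
  (n.unpair.1 = 1 ∧
    ((n.unpair.2.unpair.2 = 0 ∧ digit 2 z n.unpair.2.unpair.1 = 1) ∨
      (n.unpair.2.unpair.2 ≠ 0 ∧
        digit 2 (digit N w (digit N e (n.unpair.2.unpair.2 - 1).unpair.1))
          n.unpair.2.unpair.1 = 1))) ∨
  (n.unpair.1 = 2 ∧ T n.unpair.2.unpair.1 e ∧ T n.unpair.2.unpair.2 e) ∨
  (n.unpair.1 = 3 ∧ (T n.unpair.2.unpair.1 e ∨ T n.unpair.2.unpair.2 e)) ∨
  (n.unpair.1 = 4 ∧ (¬ T n.unpair.2.unpair.1 e ∨ T n.unpair.2.unpair.2 e)) ∨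
  (n.unpair.1 = 5 ∧ ∀ e' < N ^ L,
    ¬ (∀ y < L, y = Nat.pair 0 n.unpair.2.unpair.1 ∨ digit N e' y = digit N e y) ∨
      T n.unpair.2.unpair.2 e') ∨
  (n.unpair.1 = 6 ∧ ∃ e' < N ^ L,
    (∀ y < L, y = Nat.pair 0 n.unpair.2.unpair.1 ∨ digit N e' y = digit N e y) ∧
      T n.unpair.2.unpair.2 e')

open Classical in
/-- The truth table, indexed by the numbers `e < N ^ L`, of the formula whose code is the length of
the list of the truth tables of the formulas with smaller codes. The parameters are `(N, L, w, z)`. -/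
noncomputable def truthStep (a : ℕ × ℕ × ℕ × ℕ) (l : List (List Bool)) : List Bool :=
  (List.range (a.1 ^ a.2.1)).map fun e => decide
    (TruthStep a.1 a.2.1 a.2.2.1 a.2.2.2 (fun i e => (l.getD i []).getD e false = true) l.length e)

/-- Truth of the formula with code `n` at `e < N ^ L`. -/
def Truth (N L w z n e : ℕ) : Prop :=
  (truthStep (N, L, w, z) (courseOfValues truthStep (N, L, w, z) n)).getD e false = true

theorem TruthStep.congr {N L w z : ℕ} {T T' : ℕ → ℕ → Prop} {n : ℕ}
    (h : ∀ i < n, ∀ e, (T i e ↔ T' i e)) (e : ℕ) :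
    TruthStep N L w z T n e ↔ TruthStep N L w z T' n e := by
  by_cases h0 : n.unpair.1 = 0
  · simp [TruthStep, h0]
  · simp only [TruthStep, h _ (unpair_snd_fst_lt h0), h _ (unpair_snd_snd_lt h0)]

/-- The bound on `e` is needed because tables have length `N ^ L` and lookups beyond it return
`false`. Whole tables are stored because a quantifier consults its body at other assignments. -/
theorem truth_iff {N L w z : ℕ} (n : ℕ) {e : ℕ} (he : e < N ^ L) :
    Truth N L w z n e ↔ TruthStep N L w z (Truth N L w z) n e := by
  classical
  rw [Truth, truthStep, List.getD_eq_getElem _ _ (by simpa using he), List.getElem_map,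
    List.getElem_range, decide_eq_true_iff, length_courseOfValues]
  refine TruthStep.congr (fun i hi e => ?_) e
  rw [getD_courseOfValues _ _ _ hi, Truth]

theorem primrec_truthStep : Primrec₂ truthStep := by
  let X := (ℕ × ℕ × ℕ × ℕ) × List (List Bool)
  have fst {β : Type} [Primcodable β] {f : β → ℕ} (hf : Primrec f) :
      Primrec fun x => (f x).unpair.1 := Primrec.fst.comp (Primrec.unpair.comp hf)
  have snd {β : Type} [Primcodable β] {f : β → ℕ} (hf : Primrec f) :
      Primrec fun x => (f x).unpair.2 := Primrec.snd.comp (Primrec.unpair.comp hf)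
  have hN : Primrec fun x : X => x.1.1 := Primrec.fst.comp Primrec.fst
  have hL : Primrec fun x : X => x.1.2.1 :=
    Primrec.fst.comp (Primrec.snd.comp Primrec.fst)
  have hw : Primrec fun x : X => x.1.2.2.1 :=
    Primrec.fst.comp (Primrec.snd.comp (Primrec.snd.comp Primrec.fst))
  have hz : Primrec fun x : X => x.1.2.2.2 :=
    Primrec.snd.comp (Primrec.snd.comp (Primrec.snd.comp Primrec.fst))
  have hl : Primrec fun x : X => x.2 := Primrec.snd
  have hn : Primrec fun x : X => x.2.length := Primrec.list_length.comp hl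
  have hx : Primrec fun y : X × ℕ => y.1 := Primrec.fst
  have he : Primrec fun y : X × ℕ => y.2 := Primrec.snd
  have ht : Primrec fun y : X × ℕ => y.1.2.length.unpair.1 := fst (hn.comp hx)
  have ha : Primrec fun y : X × ℕ => y.1.2.length.unpair.2.unpair.1 := fst (snd (hn.comp hx))
  have hb : Primrec fun y : X × ℕ => y.1.2.length.unpair.2.unpair.2 := snd (snd (hn.comp hx))
  have c {f : X × ℕ → ℕ} (hf : Primrec f) (k : ℕ) : PrimrecPred fun y => f y = k :=
    primrecPred_eq hf (Primrec.const k)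
  have hT {β : Type} [Primcodable β] {l : β → List (List Bool)} {f g : β → ℕ} (hl : Primrec l)
      (hf : Primrec f) (hg : Primrec g) :
      PrimrecPred fun y => ((l y).getD (f y) []).getD (g y) false = true :=
    primrecPred_eq_true ((Primrec.list_getD false).comp ((Primrec.list_getD []).comp hl hf) hg)
  have hE : Primrec fun y : X × ℕ => y.1.1.1 ^ y.1.1.2.1 :=
    primrec_nat_pow (hN.comp hx) (hL.comp hx)
  have hagree : PrimrecPred fun v : ℕ × X × ℕ => ∀ y < v.2.1.1.2.1,
      y = Nat.pair 0 v.2.1.2.length.unpair.2.unpair.1 ∨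
        digit v.2.1.1.1 v.1 y = digit v.2.1.1.1 v.2.2 y := by
    have hN' : Primrec fun u : ℕ × ℕ × X × ℕ => u.2.2.1.1.1 :=
      (hN.comp hx).comp (Primrec.snd.comp Primrec.snd)
    refine primrecPred_forall_lt ((hL.comp hx).comp Primrec.snd) (.or ?_ ?_)
    · exact primrecPred_eq Primrec.fst (Primrec₂.natPair.comp (Primrec.const 0)
        (ha.comp (Primrec.snd.comp Primrec.snd)))
    · exact primrecPred_eq (primrec_digit hN' (Primrec.fst.comp Primrec.snd) Primrec.fst)
        (primrec_digit hN' (he.comp (Primrec.snd.comp Primrec.snd)) Primrec.fst)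
  have hT' : PrimrecPred fun v : ℕ × X × ℕ =>
      (v.2.1.2.getD v.2.1.2.length.unpair.2.unpair.2 []).getD v.1 false = true :=
    hT ((hl.comp hx).comp Primrec.snd) (hb.comp Primrec.snd) Primrec.fst
  have key : PrimrecPred fun y : X × ℕ =>
      TruthStep y.1.1.1 y.1.1.2.1 y.1.1.2.2.1 y.1.1.2.2.2
        (fun i e => (y.1.2.getD i []).getD e false = true) y.1.2.length y.2 := by
    refine .or (.and (c ht 1) (.or (.and (c hb 0) ?_) (.and (c hb 0).not ?_))) <|
      .or (.and (c ht 2) (.and ?_ ?_)) <| .or (.and (c ht 3) (.or ?_ ?_)) <|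
      .or (.and (c ht 4) (.or (.not ?_) ?_)) <| .or (.and (c ht 5) ?_) (.and (c ht 6) ?_)
    · exact c (primrec_digit (Primrec.const 2) (hz.comp hx) ha) 1
    · exact c (primrec_digit (Primrec.const 2) (primrec_digit (hN.comp hx) (hw.comp hx)
        (primrec_digit (hN.comp hx) he
          (fst (Primrec.nat_sub.comp hb (Primrec.const 1))))) ha) 1
    · exact hT (hl.comp hx) ha he
    · exact hT (hl.comp hx) hb he
    · exact hT (hl.comp hx) ha he
    · exact hT (hl.comp hx) hb he
    · exact hT (hl.comp hx) ha he
    · exact hT (hl.comp hx) hb he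
    · exact primrecPred_forall_lt hE (hagree.not.or hT')
    · exact primrecPred_exists_lt hE (hagree.and hT')
  classical
  exact Primrec.list_map (Primrec.list_range.comp (primrec_nat_pow hN hL)) key.decide

theorem primrecPred_truth {α : Type*} [Primcodable α] {N L w z n e : α → ℕ} (hN : Primrec N)
    (hL : Primrec L) (hw : Primrec w) (hz : Primrec z) (hn : Primrec n) (he : Primrec e) :
    PrimrecPred fun a => Truth (N a) (L a) (w a) (z a) (n a) (e a) := by
  have hp := hN.pair (hL.pair (hw.pair hz))
  exact primrecPred_eq_true ((Primrec.list_getD false).comp (primrec_truthStep.comp hp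
    ((primrec_courseOfValues primrec_truthStep).comp hp hn)) he)

/-! ### The finite model property -/

/-- The element `u` satisfies those of the first `L` unary predicates that the element `i` of the
finite interpretation given by `N` and `w` satisfies. -/
def ClassicalInterpretation.SameType (M : ClassicalInterpretation.{u}) (N L w : ℕ) (u : M.U)
    (i : ℕ) : Prop :=
  ∀ k < L, (digit 2 (digit N w i) k = 1 ↔ M.pred 1 k fun _ => u)

/-- The digit at each term code is chosen as an index with the type of the term's value.
`Function.extend` gives an arbitrary value at numbers that code no term. -/
theorem ClassicalInterpretation.exists_env (M : ClassicalInterpretation.{u}) {N L w : ℕ}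
    (htot : ∀ u, ∃ i < N, M.SameType N L w u i) (s : ℕ → M.U) :
    ∃ e < N ^ L, ∀ t : Term, t.code < L →
      M.SameType N L w (t.eval M.fn s) (digit N e t.code) := by
  choose idx hlt hidx using htot
  obtain ⟨e, he, h⟩ := exists_digit_eq L (b := N)
    (f := fun c => idx (Function.extend Term.code (fun t => t.eval M.fn s)
      (fun _ => M.nonempty.some) c)) fun _ _ => hlt _
  refine ⟨e, he, fun t ht => ?_⟩
  rw [h _ ht, Term.code_injective.extend_apply]
  exact hidx _

/-- Function-free terms other than the variable `x` do not depend on the value of `x`. -/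
theorem Term.eval_update {U : Type u} (fn : (n k : ℕ) → (Fin n → U) → U) (s : ℕ → U) {x : ℕ}
    (a : U) {t : Term} (ht : t.IsFunctionFree) (htx : t ≠ .var x) :
    t.eval fn (Function.update s x a) = t.eval fn s := by
  cases t with
  | var y =>
    have : y ≠ x := fun h => htx (h ▸ rfl)
    simp [Term.eval, this]
  | app n k ts =>
    obtain rfl : n = 0 := ht
    exact congrArg (fn 0 k) (funext fun i => i.elim0)

/-- A back-and-forth argument: `SameType` is a relation between `M` and the finite model that is
total on both sides (`htot`, `hsur`). Without equality it need not be a bijection, so several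
indices may share a type. -/
theorem ClassicalInterpretation.truth_code_iff (M : ClassicalInterpretation.{u}) {N L w z : ℕ}
    (hN : 0 < N) (htot : ∀ u, ∃ i < N, M.SameType N L w u i)
    (hsur : ∀ i < N, ∃ u, M.SameType N L w u i)
    (hz : ∀ k < L, (digit 2 z k = 1 ↔ M.pred 0 k Fin.elim0))
    {A : Formula} (hA : A.IsMonadic) (hAL : A.code ≤ L) {s : ℕ → M.U} {e : ℕ} (he : e < N ^ L)
    (hs : ∀ t : Term, t.IsFunctionFree → t.code < L →
      M.SameType N L w (t.eval M.fn s) (digit N e t.code)) :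
    Truth N L w z A.code e ↔ M.Holds A s := by
  have hlt {i a b : ℕ} (h : Nat.pair (i + 1) (Nat.pair a b) ≤ L) : a < L ∧ b < L := by
    have h1 := Nat.add_le_pair (i + 1) (Nat.pair a b)
    have h2 := Nat.add_le_pair a b
    omega
  -- An assignment for `e'` that differs from `s` only at `x`
  have hext {x e₁ e₂ : ℕ} {s : ℕ → M.U} {a : M.U}
      (hs : ∀ t : Term, t.IsFunctionFree → t.code < L →
        M.SameType N L w (t.eval M.fn s) (digit N e₁ t.code))
      (hag : ∀ y < L, y = Nat.pair 0 x ∨ digit N e₂ y = digit N e₁ y)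
      (ha : (Nat.pair 0 x < L → M.SameType N L w a (digit N e₂ (Nat.pair 0 x)))) (t : Term)
      (ht : t.IsFunctionFree) (htL : t.code < L) :
      M.SameType N L w (t.eval M.fn (Function.update s x a)) (digit N e₂ t.code) := by
    by_cases htx : t = .var x
    · subst htx
      simpa [Term.eval, Term.code] using ha htL
    · rw [Term.eval_update _ _ _ ht htx, (hag _ htL).resolve_left fun h => htx
        (Term.code_injective h)]
      exact hs t ht htL
  -- Only the digit of the variable `x` is changed, to an index of the type of `a`. If the code of
  -- `x` is at least `L`, it is not recorded in the environment and nothing is required.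
  have hback (x e₁ : ℕ) (a : M.U) : ∃ e₂ < N ^ L,
      (∀ y < L, y = Nat.pair 0 x ∨ digit N e₂ y = digit N e₁ y) ∧
      (Nat.pair 0 x < L → M.SameType N L w a (digit N e₂ (Nat.pair 0 x))) := by
    obtain ⟨i, hi, hai⟩ := htot a
    obtain ⟨e₂, he₂, h⟩ := exists_digit_eq L (b := N)
      (f := Function.update (digit N e₁) (Nat.pair 0 x) i) fun y _ => by
        rcases eq_or_ne y (Nat.pair 0 x) with rfl | hy
        · simpa using hi
        · simpa [hy] using digit_lt hN e₁ y
    refine ⟨e₂, he₂, fun y hy => ?_, fun hx => ?_⟩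
    · by_cases hyx : y = Nat.pair 0 x
      · exact .inl hyx
      · exact .inr (by rw [h y hy, Function.update_of_ne hyx])
    · rwa [h _ hx, Function.update_self]
  induction A generalizing s e with
  | bot => rw [truth_iff _ he]; simp [TruthStep, Formula.code, ClassicalInterpretation.Holds]
  | atom n k ts =>
    obtain ⟨hn, hts⟩ := hA
    rw [truth_iff _ he]
    obtain ⟨hk, hl⟩ := hlt hAL
    rcases Nat.le_one_iff_eq_zero_or_eq_one.1 hn with rfl | rfl
    · have : (fun i => (ts i).eval M.fn s) = Fin.elim0 := Subsingleton.elim _ _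
      simp [TruthStep, Formula.code, ClassicalInterpretation.Holds, hz k hk, this]
    · have ht : (ts 0).code < L := by
        have h1 := Nat.left_le_pair (ts 0).code 0
        simp at hl
        omega
      have : (fun i => (ts i).eval M.fn s) = fun _ => (ts 0).eval M.fn s := by
        funext i
        rw [Subsingleton.elim i 0]
      simp [TruthStep, Formula.code, ClassicalInterpretation.Holds, this,
        hs _ (hts 0) ht k hk]
  | and A B ihA ihB =>
    obtain ⟨hAL, hBL⟩ := hlt hAL
    rw [truth_iff _ he]
    simp [TruthStep, Formula.code, ClassicalInterpretation.Holds, ihA hA.1 hAL.le he hs,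
      ihB hA.2 hBL.le he hs]
  | or A B ihA ihB =>
    obtain ⟨hAL, hBL⟩ := hlt hAL
    rw [truth_iff _ he]
    simp [TruthStep, Formula.code, ClassicalInterpretation.Holds, ihA hA.1 hAL.le he hs,
      ihB hA.2 hBL.le he hs]
  | imp A B ihA ihB =>
    obtain ⟨hAL, hBL⟩ := hlt hAL
    rw [truth_iff _ he]
    simp [TruthStep, Formula.code, ClassicalInterpretation.Holds, ihA hA.1 hAL.le he hs,
      ihB hA.2 hBL.le he hs, imp_iff_not_or]
  | all x A ih =>
    obtain ⟨-, hAL⟩ := hlt hAL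
    rw [truth_iff _ he]
    simp only [TruthStep, Formula.code, ClassicalInterpretation.Holds, Nat.unpair_pair,
      ← imp_iff_not_or]
    norm_num
    constructor
    · intro h a
      obtain ⟨e', he', hag, ha⟩ := hback x e a
      exact (ih hA hAL.le he' (hext hs hag ha)).1 (h e' he' hag)
    · intro h e' he' hag
      obtain ⟨a, ha⟩ := hsur _ (digit_lt hN e' (Nat.pair 0 x))
      exact (ih hA hAL.le he' (hext hs hag fun _ => ha)).2 (h a)
  | ex x A ih =>
    obtain ⟨-, hAL⟩ := hlt hAL
    rw [truth_iff _ he]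
    simp only [TruthStep, Formula.code, ClassicalInterpretation.Holds, Nat.unpair_pair]
    norm_num
    constructor
    · rintro ⟨e', he', hag, h⟩
      obtain ⟨a, ha⟩ := hsur _ (digit_lt hN e' (Nat.pair 0 x))
      exact ⟨a, (ih hA hAL.le he' (hext hs hag fun _ => ha)).1 h⟩
    · rintro ⟨a, h⟩
      obtain ⟨e', he', hag, ha⟩ := hback x e a
      exact ⟨e', he', hag, (ih hA hAL.le he' (hext hs hag ha)).2 h⟩

/-- The classical interpretation with universe `{0, …, N - 1}` given by `w`, `z` and `e`. -/
def finiteInterpretation {N : ℕ} (hN : 0 < N) (w z e : ℕ) : ClassicalInterpretation.{u} where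
  U := ULift (Fin N)
  nonempty := ⟨⟨⟨0, hN⟩⟩⟩
  -- The digit position is the code of the `k`-th constant. Function symbols of positive arity do
  -- not occur in monadic formulas, so their values are immaterial.
  fn _ k _ := ⟨⟨digit N e (Nat.pair 1 (Nat.pair k 0)), digit_lt hN _ _⟩⟩
  pred
    | 0, k, _ => digit 2 z k = 1
    | 1, k, v => digit 2 (digit N w (v 0).down) k = 1
    | _, _, _ => False
  var x := ⟨⟨digit N e (Nat.pair 0 x), digit_lt hN _ _⟩⟩

theorem classicallySatisfiable_iff_exists_truth {A : Formula} (hA : A.IsMonadic) {L N : ℕ}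
    (hL : A.code = L) (hN : 2 ^ L = N) :
    ClassicallySatisfiable.{u} A ↔
      ∃ w < N ^ N, ∃ z < N, ∃ e < N ^ L, Truth N L w z L e := by
  have hpos : 0 < N := hN ▸ Nat.two_pow_pos L
  constructor
  · rintro ⟨M, hM⟩
    classical
    obtain ⟨z, hz, hzM⟩ := exists_bits_iff L fun k => M.pred 0 k Fin.elim0
    choose τ hτ hτM using fun u : M.U => exists_bits_iff L fun k => M.pred 1 k fun _ => u
    -- The index `i` represents the type `i` if it is realized in `M`, and otherwise repeats the
    -- type of an arbitrary element; so every index has a realized type, as `hsur` requires.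
    let f : ℕ → M.U := fun i => if h : ∃ u, τ u = i then h.choose else M.nonempty.some
    have hf : ∀ u, τ (f (τ u)) = τ u := fun u => by
      have h : ∃ u', τ u' = τ u := ⟨u, rfl⟩
      simp only [f, dif_pos h]
      exact h.choose_spec
    obtain ⟨w, hw, hwf⟩ := exists_digit_eq N (b := N) (f := fun i => τ (f i))
      fun i _ => hN ▸ hτ _
    have htot : ∀ u, ∃ i < N, M.SameType N L w u i := fun u => by
      refine ⟨τ u, hN ▸ hτ u, ?_⟩
      rw [ClassicalInterpretation.SameType, hwf _ (hN ▸ hτ u), hf]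
      exact hτM u
    have hsur : ∀ i < N, ∃ u, M.SameType N L w u i := fun i hi => by
      refine ⟨f i, ?_⟩
      rw [ClassicalInterpretation.SameType, hwf i hi]
      exact hτM _
    obtain ⟨e, he, hs⟩ := M.exists_env htot M.var
    refine ⟨w, hw, z, hN ▸ hz, e, he, ?_⟩
    conv => arg 5; rw [← hL]
    exact (M.truth_code_iff hpos htot hsur hzM hA hL.le he fun t _ => hs t).2 hM
  · rintro ⟨w, -, z, -, e, he, h⟩
    refine ⟨finiteInterpretation hpos w z e, ?_⟩
    rw [← (finiteInterpretation hpos w z e).truth_code_iff (L := L) (w := w) (z := z) (e := e)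
      hpos ?_ ?_ ?_ hA hL.le he ?_]
    · rwa [hL]
    · exact fun u => ⟨u.down, u.down.2, fun k _ => Iff.rfl⟩
    · exact fun i hi => ⟨⟨⟨i, hi⟩⟩, fun k _ => Iff.rfl⟩
    · exact fun k _ => Iff.rfl
    · intro t ht _ k _
      cases t with
      | var x => exact Iff.rfl
      | app n j ts =>
        obtain rfl : n = 0 := ht
        simp [finiteInterpretation, Term.eval, Term.code]

/-- All search bounds are primitive recursive in the code `m`, with `2 ^ m` as the size of the
universe. -/
theorem isDecidable_classicallySatisfiable :
    IsDecidable {A | A.IsMonadic ∧ ClassicallySatisfiable.{u} A} := by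
  have key : PrimrecPred fun m : ℕ => IsMonadicCode m ∧ ∃ w < (2 ^ m) ^ (2 ^ m), ∃ z < 2 ^ m,
      ∃ e < (2 ^ m) ^ m, Truth (2 ^ m) m w z m e := by
    have hN : Primrec fun m : ℕ => 2 ^ m := primrec_nat_pow (Primrec.const 2) Primrec.id
    have h2 : Primrec fun v : ℕ × ℕ => v.2 := Primrec.snd
    have h3 : Primrec fun v : ℕ × ℕ × ℕ => v.2.2 := Primrec.snd.comp Primrec.snd
    have h4 : Primrec fun v : ℕ × ℕ × ℕ × ℕ => v.2.2.2 := h3.comp Primrec.snd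
    refine primrecPred_isMonadicCode.and (primrecPred_exists_lt (primrec_nat_pow hN hN)
      (primrecPred_exists_lt (hN.comp h2)
      (primrecPred_exists_lt (primrec_nat_pow (hN.comp h3) h3) ?_)))
    exact primrecPred_truth (hN.comp h4) h4 (Primrec.fst.comp (Primrec.snd.comp Primrec.snd))
      (Primrec.fst.comp Primrec.snd) h4 Primrec.fst
  refine key.computablePred.of_eq fun m => ?_
  rw [isMonadicCode_iff_exists]
  constructor
  · rintro ⟨⟨A, hA, hm⟩, h⟩
    exact ⟨A, ⟨hA, (classicallySatisfiable_iff_exists_truth hA hm rfl).2 h⟩, hm⟩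
  · rintro ⟨A, ⟨hA, hs⟩, hm⟩
    exact ⟨⟨A, hA, hm⟩, (classicallySatisfiable_iff_exists_truth hA hm rfl).1 hs⟩

end GodelLogic

theorem mainTheorem11 (V : Set ℝ) (hV : GodelLogic.IsGodelSet V)
    (h0 : ¬ AccPt (0 : ℝ) (Filter.principal V)) :
    (∀ A : GodelLogic.Formula, A.IsMonadic →
      (GodelLogic.OneSatisfiable.{u} V A ↔ GodelLogic.ClassicallySatisfiable.{u} A)) ∧
    GodelLogic.IsDecidable {A | A.IsMonadic ∧ GodelLogic.OneSatisfiable.{u} V A} := by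
  refine ⟨fun A _ => GodelLogic.oneSatisfiable_iff_classicallySatisfiable hV h0 A, ?_⟩
  simp only [GodelLogic.oneSatisfiable_iff_classicallySatisfiable hV h0]
  exact GodelLogic.isDecidable_classicallySatisfiable
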